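/- Fix a universe of sets; "small" means small with respect to it. For a regular cardinal $\kappa$, a (small or essentially small) category $J$ is $\kappa$-filtered if every functor $A \to J$ from a small category $A$ with fewer than $\kappa$ morphisms admits a cocone. For a category $\mathcal{C}$, let $\operatorname{Ind}_\kappa(\mathcal{C})$ be the category of pairs $\langle J, i\rangle$ of a small $\kappa$-filtered category $J$ and a functor $i : J \to \mathcal{C}$, with $$\operatorname{Hom}(\langle J,i\rangle,\langle J',i'\rangle) = \lim_{j\in J^{o}}\operatorname{colim}_{j'\in J'}\operatorname{Hom}_{\mathcal{C}}(i_j,i'_{j'}).$$ For a regular cardinal $\mu \ge \kappa$, an object $X \in \operatorname{Ind}_\kappa(\mathcal{C})$ is $\mu$-compact if $\operatorname{Hom}(X,-)$ preserves $\mu$-filtered colimits, and $\operatorname{Ind}_\kappa^\mu(\mathcal{C}) \subset \operatorname{Ind}_\kappa(\mathcal{C})$ denotes the full subcategory spanned by the $\mu$-compact objects. Corollary. For any regular cardinals $\mu \ge \kappa$ and any essentially small category $\mathcal{C}$, the category $\operatorname{Ind}_\kappa^\mu(\mathcal{C})$ is essentially small, i.e. equivalent to a small category. -/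

import Mathlib

open CategoryTheory CategoryTheory.Limits Opposite

universe w v u

/-- The objects of `Ind_κ(C)`: pairs `⟨J, i⟩` of a small `κ`-filtered category `J` and a functor
`i : J ⥤ C`. "Small" refers to the universe `w` in which the cardinal `κ` lives. -/
structure IndCat (κ : Cardinal.{w}) [Fact κ.IsRegular] (C : Type u) [Category.{v} C] where
  /-- the indexing category -/
  J : Type w
  [cat : SmallCategory J]
  [filt : IsCardinalFiltered J κ]
  /-- the diagram -/
  diag : J ⥤ C

namespace IndCat

attribute [instance] IndCat.cat IndCat.filt

variable {κ : Cardinal.{w}} [Fact κ.IsRegular] {C : Type u} [Category.{v} C]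

/-- The presheaf `c ↦ colim_{j ∈ J} Hom(c, i_j)` attached to `⟨J, i⟩`. -/
def presheaf (Y : IndCat κ C) : Cᵒᵖ ⥤ Type (max w v) where
  obj c := (Y.diag ⋙ coyoneda.obj c).ColimitType
  map {c d} f := TypeCat.ofHom ((Y.diag ⋙ coyoneda.obj c).descColimitType
    { pt := (Y.diag ⋙ coyoneda.obj d).ColimitType
      ι := fun j g => (Y.diag ⋙ coyoneda.obj d).ιColimitType j
        ((f.unop ≫ (show c.unop ⟶ Y.diag.obj j from g) : d.unop ⟶ Y.diag.obj j))
      ι_naturality := fun {j j'} a => by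
        funext g
        have h := (Y.diag ⋙ coyoneda.obj d).ιColimitType_map a
          ((f.unop ≫ (show c.unop ⟶ Y.diag.obj j from g) : d.unop ⟶ Y.diag.obj j))
        simpa using h })
  map_id c := by
    ext t
    obtain ⟨j, g, rfl⟩ := Functor.ιColimitType_jointly_surjective _ t
    simp
  map_comp f g := by
    ext t
    obtain ⟨j, g, rfl⟩ := Functor.ιColimitType_jointly_surjective _ t
    simp

/-- The class in `colim_{j ∈ J} Hom(c, i_j)` of a morphism `g : c ⟶ i_j`. -/
def germ (Y : IndCat κ C) {c : C} (j : Y.J) (g : c ⟶ Y.diag.obj j) : Y.presheaf.obj (op c) :=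
  (Y.diag ⋙ coyoneda.obj (op c)).ιColimitType j g

lemma exists_germ (Y : IndCat κ C) {c : C} (t : Y.presheaf.obj (op c)) :
    ∃ (j : Y.J) (g : c ⟶ Y.diag.obj j), Y.germ j g = t :=
  Functor.ιColimitType_jointly_surjective _ t

@[simp]
lemma germ_comp_map (Y : IndCat κ C) {c : C} {j j' : Y.J} (g : c ⟶ Y.diag.obj j) (a : j ⟶ j') :
    Y.germ j' (g ≫ Y.diag.map a) = Y.germ j g :=
  (Y.diag ⋙ coyoneda.obj (op c)).ιColimitType_map a g

@[simp]
lemma presheaf_map_germ (Y : IndCat κ C) {c d : C} (f : d ⟶ c) (j : Y.J)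
    (g : c ⟶ Y.diag.obj j) : Y.presheaf.map f.op (Y.germ j g) = Y.germ j (f ≫ g) :=
  rfl

/-- Morphisms `⟨J, i⟩ ⟶ ⟨J', i'⟩`: the set `lim_{j ∈ Jᵒᵖ} colim_{j' ∈ J'} Hom(i_j, i'_{j'})`,
the limit being realised as the set of compatible families. -/
@[ext]
structure Hom (X Y : IndCat κ C) where
  /-- the compatible family -/
  fam : (X.diag.op ⋙ Y.presheaf).sections

/-- The `j`-th component of a morphism, an element of `colim_{j' ∈ J'} Hom(i_j, i'_{j'})`. -/
def Hom.component {X Y : IndCat κ C} (φ : Hom X Y) (j : X.J) : Y.presheaf.obj (op (X.diag.obj j)) :=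
  φ.fam.1 (op j)

lemma Hom.map_component {X Y : IndCat κ C} (φ : Hom X Y) {j j' : X.J} (a : j ⟶ j') :
    Y.presheaf.map (X.diag.map a).op (φ.component j') = φ.component j :=
  φ.fam.2 a.op

lemma Hom.ext_component {X Y : IndCat κ C} {φ ψ : Hom X Y} (h : ∀ j, φ.component j = ψ.component j) :
    φ = ψ :=
  Hom.ext (Subtype.ext (funext fun j => h j.unop))

/-- The map `colim_j Hom(c, i_j) → colim_{j'} Hom(c, i'_{j'})` given by composition with a
morphism `φ`: it sends the class of `g : c ⟶ i_j` to `g^*(φ_j)`. -/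
def Hom.app {X Y : IndCat κ C} (φ : Hom X Y) (c : C) :
    X.presheaf.obj (op c) → Y.presheaf.obj (op c) :=
  (X.diag ⋙ coyoneda.obj (op c)).descColimitType
    { pt := Y.presheaf.obj (op c)
      ι := fun j g => Y.presheaf.map (show c ⟶ X.diag.obj j from g).op (φ.component j)
      ι_naturality := fun {j j'} a => by
        funext g
        change Y.presheaf.map ((show c ⟶ X.diag.obj j from g) ≫ X.diag.map a).op (φ.component j') = _
        rw [op_comp, Functor.map_comp, types_comp_apply, φ.map_component] }

@[simp]
lemma Hom.app_germ {X Y : IndCat κ C} (φ : Hom X Y) {c : C} (j : X.J) (g : c ⟶ X.diag.obj j) :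
    φ.app c (X.germ j g) = Y.presheaf.map g.op (φ.component j) :=
  rfl

lemma Hom.app_map {X Y : IndCat κ C} (φ : Hom X Y) {c d : C} (f : d ⟶ c)
    (t : X.presheaf.obj (op c)) :
    φ.app d (X.presheaf.map f.op t) = Y.presheaf.map f.op (φ.app c t) := by
  obtain ⟨j, g, rfl⟩ := X.exists_germ t
  simp

instance : Category.{max w v} (IndCat κ C) where
  Hom X Y := Hom X Y
  id X :=
    { fam := ⟨fun j => X.germ j.unop (𝟙 (X.diag.obj j.unop)), fun {j j'} a => by
        have h := X.germ_comp_map (𝟙 (X.diag.obj j'.unop)) a.unop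
        change X.germ j.unop (X.diag.map a.unop ≫ 𝟙 _) = _
        simpa using h⟩ }
  comp {X Y Z} φ ψ :=
    { fam := ⟨fun j => ψ.app (X.diag.obj j.unop) (φ.component j.unop), fun {j j'} a => by
        change Z.presheaf.map (X.diag.map a.unop).op _ = _
        rw [← ψ.app_map, φ.map_component]⟩ }
  id_comp {X Y} φ := Hom.ext_component fun j => by
    change Y.presheaf.map (𝟙 (X.diag.obj j)).op (φ.component j) = φ.component j
    simp
  comp_id {X Y} φ := Hom.ext_component fun j => by
    obtain ⟨j', g, hg⟩ := Y.exists_germ (φ.component j)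
    change Hom.app _ _ (φ.component j) = φ.component j
    rw [← hg]
    change Y.germ j' (g ≫ 𝟙 _) = _
    rw [Category.comp_id]
  assoc {X Y Z W} φ ψ χ := Hom.ext_component fun j => by
    obtain ⟨j', g, hg⟩ := Y.exists_germ (φ.component j)
    change χ.app _ (ψ.app _ (φ.component j)) = Hom.app _ _ (φ.component j)
    rw [← hg, Hom.app_germ, Hom.app_germ, Hom.app_map]
    rfl

end IndCat

/-- `Ind_κ^μ(C)`: the full subcategory of `Ind_κ(C)` spanned by the `μ`-compact objects, that is,
by the objects `X` such that `Hom(X, -)` preserves colimits over small `μ`-filtered categories. -/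
abbrev IndComp (κ μ : Cardinal.{w}) [Fact κ.IsRegular] [Fact μ.IsRegular]
    (C : Type u) [Category.{v} C] :=
  (isCardinalPresentable (IndCat κ C) μ).FullSubcategory

/-! Every object of `Ind_κ(C)` can be indexed by a `κ`-directed poset `A`. Suppose `ν > κ` is
regular and sets with fewer than `ν` elements have fewer than `ν` subsets of cardinality `< κ`. Then
every subset of `A` of cardinality `< ν` lies in a `κ`-directed one of cardinality `< ν`. Hence the
object is a `ν`-filtered colimit of its restrictions to such subsets (`isColimitRestrictCocone`),
and if it is `ν`-compact, its identity factors through one of them: it is a retract of an object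
with fewer than `ν` index morphisms. Taking `ν > μ` as well, `μ`-compact objects are `ν`-compact.
Objects with fewer than `ν` index morphisms form a set up to isomorphism, and so do their retracts,
by local smallness. -/

lemma hasCardinalLT_arrow_of_preorder {P : Type u} [Preorder P] {ν : Cardinal.{w}}
    (hν : Cardinal.aleph0 ≤ ν) (hP : HasCardinalLT P ν) : HasCardinalLT (Arrow P) ν :=
  (hasCardinalLT_prod hν hP hP).of_injective (fun f : Arrow P => (f.left, f.right))
    fun f g hfg => by
      obtain ⟨a, b, f⟩ := f
      obtain ⟨a', b', g⟩ := g
      obtain ⟨rfl, rfl⟩ := Prod.mk.inj hfg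
      rw [Subsingleton.elim (α := a ⟶ b) f g]

/-- The successor of `2 ^ μ` works: `(2 ^ μ) ^ κ = 2 ^ (μ * κ) = 2 ^ μ` because `κ ≤ μ`. -/
lemma Cardinal.exists_isRegular_forall_hasCardinalLT_setCardinalLT (κ μ : Cardinal.{w})
    [Fact κ.IsRegular] [Fact μ.IsRegular] (h : κ ≤ μ) :
    ∃ ν : Cardinal.{w}, ν.IsRegular ∧ μ < ν ∧
      ∀ X : Type w, HasCardinalLT X ν →
        HasCardinalLT (CardinalDirectedPoset.SetCardinalLT κ X) ν := by
  have hμ : Cardinal.aleph0 ≤ μ := (Fact.out : μ.IsRegular).aleph0_le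
  have h2 : Cardinal.aleph0 ≤ 2 ^ μ := hμ.trans (Cardinal.cantor μ).le
  refine ⟨Order.succ (2 ^ μ), Cardinal.isRegular_succ h2,
    (Cardinal.cantor μ).trans (Order.lt_succ _), fun X hX => ?_⟩
  rw [hasCardinalLT_iff_cardinal_mk_lt, Order.lt_succ_iff] at hX ⊢
  have h3 : (2 ^ μ : Cardinal.{w}) ^ κ ≤ 2 ^ μ := by
    rw [← Cardinal.power_mul, Cardinal.mul_eq_left hμ h (Fact.out : κ.IsRegular).pos.ne']
  calc Cardinal.mk (CardinalDirectedPoset.SetCardinalLT κ X)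
      ≤ Cardinal.mk {t : Set X // Cardinal.mk t ≤ κ} :=
        Cardinal.mk_le_of_injective (f := fun t => ⟨t.1, by
          have := t.2
          rw [hasCardinalLT_iff_cardinal_mk_lt] at this
          exact this.le⟩) (fun s t hst => Subtype.ext (Subtype.mk.inj hst))
    _ ≤ max (Cardinal.mk X) Cardinal.aleph0 ^ κ := Cardinal.mk_bounded_set_le X κ
    _ ≤ (2 ^ μ) ^ κ := Cardinal.power_le_power_right (max_le hX h2)
    _ ≤ 2 ^ μ := h3

/-! ### Germs, isomorphisms and reindexing in `Ind_κ(C)` -/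

namespace IndCat

variable {κ : Cardinal.{w}} [Fact κ.IsRegular] {C : Type u} [Category.{v} C]

lemma isFiltered (X : IndCat κ C) : IsFiltered X.J :=
  isFiltered_of_isCardinalFiltered X.J κ

/-- Since the index category is filtered, becoming equal at a later stage is already an equivalence
relation, so no zigzags are needed. -/
lemma germ_eq_iff (X : IndCat κ C) {c : C} {j j' : X.J} (g : c ⟶ X.diag.obj j)
    (g' : c ⟶ X.diag.obj j') :
    X.germ j g = X.germ j' g' ↔
      ∃ (k : X.J) (a : j ⟶ k) (b : j' ⟶ k), g ≫ X.diag.map a = g' ≫ X.diag.map b := by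
  have := X.isFiltered
  constructor
  · intro h
    let F := X.diag ⋙ coyoneda.obj (op c)
    have h' := Quot.eqvGen_exact h
    exact (Types.FilteredColimit.rel_equiv F).eqvGen_iff.1
      (Relation.EqvGen.mono (Types.FilteredColimit.rel_of_colimitTypeRel F) _ _ h')
  · rintro ⟨k, a, b, h⟩
    rw [← X.germ_comp_map g a, ← X.germ_comp_map g' b, h]

/-- A morphism is determined by elements of the values of the presheaf of its target. -/
def homMk {X Y : IndCat κ C} (t : ∀ j : X.J, Y.presheaf.obj (op (X.diag.obj j)))
    (ht : ∀ ⦃j j' : X.J⦄ (a : j ⟶ j'), Y.presheaf.map (X.diag.map a).op (t j') = t j) : X ⟶ Y :=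
  Hom.mk ⟨fun j => t j.unop, fun a => ht a.unop⟩

@[ext]
lemma hom_ext {X Y : IndCat κ C} {φ ψ : X ⟶ Y}
    (h : ∀ j, Hom.component φ j = Hom.component ψ j) : φ = ψ :=
  Hom.ext_component h

@[simp]
lemma component_homMk {X Y : IndCat κ C} (t : ∀ j : X.J, Y.presheaf.obj (op (X.diag.obj j)))
    (ht : ∀ ⦃j j' : X.J⦄ (a : j ⟶ j'), Y.presheaf.map (X.diag.map a).op (t j') = t j) (j : X.J) :
    Hom.component (homMk t ht) j = t j :=
  rfl

@[simp]
lemma component_id (X : IndCat κ C) (j : X.J) :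
    Hom.component (𝟙 X) j = X.germ j (𝟙 _) :=
  rfl

@[simp]
lemma component_comp {X Y Z : IndCat κ C} (φ : X ⟶ Y) (ψ : Y ⟶ Z) (j : X.J) :
    Hom.component (φ ≫ ψ) j = Hom.app ψ _ (Hom.component φ j) :=
  rfl

@[simp]
lemma app_homMk_germ {X Y : IndCat κ C} (t : ∀ j : X.J, Y.presheaf.obj (op (X.diag.obj j)))
    (ht : ∀ ⦃j j' : X.J⦄ (a : j ⟶ j'), Y.presheaf.map (X.diag.map a).op (t j') = t j)
    {c : C} (j : X.J) (g : c ⟶ X.diag.obj j) :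
    Hom.app (homMk t ht) c (X.germ j g) = Y.presheaf.map g.op (t j) :=
  rfl

lemma app_germ_id {X Y : IndCat κ C} (φ : X ⟶ Y) (j : X.J) :
    Hom.app φ _ (X.germ j (𝟙 _)) = Hom.component φ j := by
  simp

/-- A Yoneda argument: the components of the inverse are the preimages of the germs of identities,
and injectivity makes them compatible. -/
lemma isIso_of_bijective_app {X Y : IndCat κ C} (φ : X ⟶ Y)
    (h : ∀ c, Function.Bijective (Hom.app φ c)) : IsIso φ := by
  choose t ht using fun j : Y.J => (h _).2 (Y.germ j (𝟙 (Y.diag.obj j)))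
  refine ⟨homMk t fun j j' a => (h _).1 ?_, ?_, ?_⟩
  · rw [Hom.app_map, ht, ht, presheaf_map_germ, Category.comp_id]
    simpa using Y.germ_comp_map (𝟙 _) a
  · ext j
    apply (h _).1
    obtain ⟨k, g, hg⟩ := Y.exists_germ (Hom.component φ j)
    rw [component_comp, ← hg, app_homMk_germ, Hom.app_map, ht]
    simp [← hg]
  · ext j
    simp [ht]

/-- The object `⟨A, F ⋙ i⟩` attached to a functor `F : A ⥤ J` and an object `⟨J, i⟩`. -/
abbrev reindex (X : IndCat κ C) {A : Type w} [SmallCategory A] [IsCardinalFiltered A κ]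
    (F : A ⥤ X.J) : IndCat κ C where
  J := A
  diag := F ⋙ X.diag

/-- The canonical morphism `⟨A, F ⋙ i⟩ ⟶ ⟨J, i⟩`. -/
def reindexHom (X : IndCat κ C) {A : Type w} [SmallCategory A] [IsCardinalFiltered A κ]
    (F : A ⥤ X.J) : X.reindex F ⟶ X :=
  homMk (X := X.reindex F) (fun a => X.germ (F.obj a) (𝟙 _)) fun a a' f => by
    simpa using X.germ_comp_map (𝟙 _) (F.map f)

@[simp]
lemma app_reindexHom_germ (X : IndCat κ C) {A : Type w} [SmallCategory A]
    [IsCardinalFiltered A κ] (F : A ⥤ X.J) {c : C} (a : A) (g : c ⟶ X.diag.obj (F.obj a)) :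
    Hom.app (X.reindexHom F) c ((X.reindex F).germ a g) = X.germ (F.obj a) g := by
  dsimp [reindexHom]
  simp

instance isIso_reindexHom (X : IndCat κ C) {A : Type w} [SmallCategory A]
    [IsCardinalFiltered A κ] (F : A ⥤ X.J) [F.Final] : IsIso (X.reindexHom F) := by
  have := isFiltered_of_isCardinalFiltered A κ
  obtain ⟨h₁, h₂⟩ := (Functor.final_iff_of_isFiltered F).1 inferInstance
  refine isIso_of_bijective_app _ fun c => ⟨fun s t hst => ?_, fun t => ?_⟩
  · obtain ⟨a, g, rfl⟩ := (X.reindex F).exists_germ s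
    obtain ⟨a', g', rfl⟩ := (X.reindex F).exists_germ t
    rw [app_reindexHom_germ, app_reindexHom_germ, germ_eq_iff] at hst
    obtain ⟨k, x, y, hxy⟩ := hst
    obtain ⟨b, ⟨z⟩⟩ := h₁ k
    let b' := IsFiltered.max (IsFiltered.max a a') b
    let p : a ⟶ b' := IsFiltered.leftToMax _ _ ≫ IsFiltered.leftToMax _ _
    let p' : a' ⟶ b' := IsFiltered.rightToMax _ _ ≫ IsFiltered.leftToMax _ _
    let q : b ⟶ b' := IsFiltered.rightToMax _ _
    -- Both arguments are parallel maps from `F.obj a` to `F.obj b'`; finality equalizes them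
    -- further along `A`. The next line does the same for `a'`, after `r`.
    obtain ⟨e, r, hr⟩ := h₂ (x ≫ z ≫ F.map q) (F.map p)
    obtain ⟨e', r', hr'⟩ := h₂ (y ≫ z ≫ F.map q ≫ F.map r) (F.map p' ≫ F.map r)
    rw [germ_eq_iff]
    refine ⟨e', p ≫ r ≫ r', p' ≫ r ≫ r', ?_⟩
    have e₁ : F.map (p ≫ r ≫ r') = x ≫ z ≫ F.map q ≫ F.map r ≫ F.map r' := by
      rw [Category.assoc, Category.assoc] at hr
      simp only [Functor.map_comp, ← reassoc_of% hr]
    have e₂ : F.map (p' ≫ r ≫ r') = y ≫ z ≫ F.map q ≫ F.map r ≫ F.map r' := by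
      simp only [Category.assoc] at hr'
      simp only [Functor.map_comp, hr']
    dsimp only [Functor.comp_map]
    rw [e₁, e₂]
    simp only [Functor.map_comp, reassoc_of% hxy]
  · obtain ⟨j, g, rfl⟩ := X.exists_germ t
    obtain ⟨a, ⟨f⟩⟩ := h₁ j
    exact ⟨(X.reindex F).germ a (g ≫ X.diag.map f),
      (X.app_reindexHom_germ F a _).trans (X.germ_comp_map g f)⟩

/-- Isomorphic diagrams define isomorphic objects. -/
lemma nonempty_iso_of_natIso {A : Type w} [SmallCategory A] [IsCardinalFiltered A κ]
    {F G : A ⥤ C} (e : F ≅ G) :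
    Nonempty ((⟨A, F⟩ : IndCat κ C) ≅ ⟨A, G⟩) := by
  have key {F G : A ⥤ C} (f : F ⟶ G) ⦃a a' : A⦄ (x : a ⟶ a') :
      (⟨A, G⟩ : IndCat κ C).presheaf.map (F.map x).op
        ((⟨A, G⟩ : IndCat κ C).germ a' (f.app a')) =
        (⟨A, G⟩ : IndCat κ C).germ a (f.app a) := by
    rw [presheaf_map_germ]
    exact (congrArg _ (f.naturality x)).trans
      ((⟨A, G⟩ : IndCat κ C).germ_comp_map (f.app a) x)
  refine ⟨⟨homMk (fun a => (⟨A, G⟩ : IndCat κ C).germ a (e.hom.app a)) (key e.hom),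
    homMk (fun a => (⟨A, F⟩ : IndCat κ C).germ a (e.inv.app a)) (key e.inv), ?_, ?_⟩⟩
  · ext a
    simp
  · ext a
    simp

/-! ### Smallness of hom-sets and of bounded index categories -/

instance locallySmall [LocallySmall.{w} C] : LocallySmall.{w} (IndCat κ C) where
  hom_small X Y := by
    have (c : C) : Small.{w} (Y.presheaf.obj (op c)) :=
      small_of_surjective (f := fun x : Σ j, (c ⟶ Y.diag.obj j) => Y.germ x.1 x.2)
        fun t => by
          obtain ⟨j, g, rfl⟩ := Y.exists_germ t
          exact ⟨⟨j, g⟩, rfl⟩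
    exact small_of_injective (β := ∀ j : X.J, Y.presheaf.obj (op (X.diag.obj j)))
      (f := fun φ => Hom.component φ) fun φ ψ h => hom_ext fun j => congrFun h j

/-- The property of being indexed by a category with fewer than `ν` morphisms. -/
def indexedByLT (κ : Cardinal.{w}) [Fact κ.IsRegular] (C : Type u) [Category.{v} C]
    (ν : Cardinal.{w}) : ObjectProperty (IndCat κ C) :=
  fun X => HasCardinalLT (Arrow X.J) ν

instance essentiallySmall_indexedByLT (ν : Cardinal.{w}) [EssentiallySmall.{w} C] :
    ObjectProperty.EssentiallySmall.{w} (indexedByLT κ C ν) where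
  exists_small_le' := by
    -- The parameters form a small set: a representative of each index category with fewer than `ν`
    -- morphisms, and a functor from it to a small model of `C`.
    let ι := Σ S : SmallCategoryCardinalLT ν,
      {_G : SmallCategoryCardinalLT.categoryFamily ν S ⥤ SmallModel.{w} C //
        IsCardinalFiltered (SmallCategoryCardinalLT.categoryFamily ν S) κ}
    let e := equivSmallModel.{w} C
    let Z (x : ι) : IndCat κ C :=
      letI := x.2.2
      ⟨SmallCategoryCardinalLT.categoryFamily ν x.1, x.2.1 ⋙ e.inverse⟩
    refine ⟨.ofObj Z, inferInstance, fun X hX => ?_⟩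
    obtain ⟨S, ⟨f⟩⟩ := SmallCategoryCardinalLT.exists_equivalence ν X.J hX
    have hS : IsCardinalFiltered (SmallCategoryCardinalLT.categoryFamily ν S) κ :=
      .of_equivalence κ f.symm
    obtain ⟨i⟩ := nonempty_iso_of_natIso (κ := κ)
      (Functor.isoWhiskerLeft (f.functor ⋙ X.diag) e.unitIso)
    exact ⟨_, ⟨(⟨S, ⟨f.functor ⋙ X.diag ⋙ e.functor, hS⟩⟩ : ι)⟩,
      ⟨(asIso (X.reindexHom f.functor)).symm ≪≫ i⟩⟩

/-- The `κ`-directed subsets with fewer than `ν` elements. -/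
abbrev DirectedSubset (A : Type w) [PartialOrder A] (κ ν : Cardinal.{w}) [Fact κ.IsRegular] :
    Type w :=
  {B : Set A // IsCardinalFiltered B κ ∧ HasCardinalLT B ν}

/-! ### Diagrams on a poset as colimits of their small restrictions -/

section Restrict

variable {A : Type w} [PartialOrder A] {ν : Cardinal.{w}} (D : A ⥤ C)

/-- The morphism in a `κ`-directed subset given by a morphism in the ambient poset. -/
def DirectedSubset.homMk (B : DirectedSubset A κ ν) {a a' : A} (h : a ⟶ a') (ha : a ∈ B.1)
    (ha' : a' ∈ B.1) : (⟨a, ha⟩ : B.1) ⟶ ⟨a', ha'⟩ :=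
  homOfLE (leOfHom h)

/-- The restriction of a diagram to a `κ`-directed subset. -/
def restrict (B : DirectedSubset A κ ν) : IndCat κ C :=
  letI := B.2.1
  ⟨B.1, (Subtype.mono_coe (· ∈ B.1)).functor ⋙ D⟩

/-- The class of a morphism `c ⟶ D a`, for `a` in the `κ`-directed subset `B`. -/
def restrictGerm (B : DirectedSubset A κ ν) {c : C} (a : A) (ha : a ∈ B.1) (g : c ⟶ D.obj a) :
    (restrict D B).presheaf.obj (op c) :=
  (restrict D B).germ (⟨a, ha⟩ : B.1) g

lemma restrictGerm_comp_map (B : DirectedSubset A κ ν) {c : C} {a a' : A} (h : a ⟶ a')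
    (ha : a ∈ B.1) (ha' : a' ∈ B.1) (g : c ⟶ D.obj a) :
    restrictGerm D B a' ha' (g ≫ D.map h) = restrictGerm D B a ha g :=
  (restrict D B).germ_comp_map (j := (⟨a, ha⟩ : B.1)) (j' := (⟨a', ha'⟩ : B.1)) g
    (DirectedSubset.homMk B h ha ha')

lemma presheaf_map_restrictGerm (B : DirectedSubset A κ ν) {c d : C} (f : d ⟶ c) {a : A}
    (ha : a ∈ B.1) (g : c ⟶ D.obj a) :
    (restrict D B).presheaf.map f.op (restrictGerm D B a ha g) =
      restrictGerm D B a ha (f ≫ g) :=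
  rfl

/-- The component of a morphism from the restriction of `D` to `B` at an element of `B`. -/
def restrictComponent {B : DirectedSubset A κ ν} {Y : IndCat κ C} (φ : restrict D B ⟶ Y)
    (a : A) (ha : a ∈ B.1) : Y.presheaf.obj (op (D.obj a)) :=
  Hom.component φ (⟨a, ha⟩ : B.1)

lemma restrictComponent_map {B : DirectedSubset A κ ν} {Y : IndCat κ C} (φ : restrict D B ⟶ Y)
    {a a' : A} (h : a ⟶ a') (ha : a ∈ B.1) (ha' : a' ∈ B.1) :
    Y.presheaf.map (D.map h).op (restrictComponent D φ a' ha') = restrictComponent D φ a ha :=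
  Hom.map_component φ (j := (⟨a, ha⟩ : B.1)) (j' := (⟨a', ha'⟩ : B.1))
    (DirectedSubset.homMk B h ha ha')

lemma restrict_hom_ext {B : DirectedSubset A κ ν} {Y : IndCat κ C} {φ ψ : restrict D B ⟶ Y}
    (h : ∀ a ha, restrictComponent D φ a ha = restrictComponent D ψ a ha) : φ = ψ :=
  hom_ext fun (j : B.1) => h j.1 j.2

/-- Constructor for morphisms from the restriction of a diagram. -/
def restrictHomMk {B : DirectedSubset A κ ν} {Y : IndCat κ C}
    (t : ∀ a, a ∈ B.1 → Y.presheaf.obj (op (D.obj a)))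
    (ht : ∀ ⦃a a' : A⦄ (h : a ⟶ a') (ha : a ∈ B.1) (ha' : a' ∈ B.1),
      Y.presheaf.map (D.map h).op (t a' ha') = t a ha) : restrict D B ⟶ Y :=
  homMk (X := restrict D B) (fun (j : B.1) => t j.1 j.2)
    fun (j j' : B.1) h => ht (homOfLE (leOfHom h)) j.2 j'.2

lemma restrictComponent_restrictHomMk {B : DirectedSubset A κ ν} {Y : IndCat κ C}
    (t : ∀ a, a ∈ B.1 → Y.presheaf.obj (op (D.obj a)))
    (ht : ∀ ⦃a a' : A⦄ (h : a ⟶ a') (ha : a ∈ B.1) (ha' : a' ∈ B.1),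
      Y.presheaf.map (D.map h).op (t a' ha') = t a ha) (a : A) (ha : a ∈ B.1) :
    restrictComponent D (restrictHomMk D t ht) a ha = t a ha :=
  rfl

lemma app_restrictGerm {B : DirectedSubset A κ ν} {Y : IndCat κ C} (φ : restrict D B ⟶ Y)
    {c : C} {a : A} (ha : a ∈ B.1) (g : c ⟶ D.obj a) :
    Hom.app φ c (restrictGerm D B a ha g) =
      Y.presheaf.map g.op (restrictComponent D φ a ha) :=
  rfl

lemma restrictComponent_comp {B : DirectedSubset A κ ν} {Y Z : IndCat κ C}
    (φ : restrict D B ⟶ Y) (ψ : Y ⟶ Z) (a : A) (ha : a ∈ B.1) :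
    restrictComponent D (φ ≫ ψ) a ha = Hom.app ψ _ (restrictComponent D φ a ha) :=
  rfl

/-- The transition morphism between two restrictions of a diagram. -/
def restrictMap {B B' : DirectedSubset A κ ν} (h : B ≤ B') : restrict D B ⟶ restrict D B' :=
  restrictHomMk D (fun a ha => restrictGerm D B' a (h ha) (𝟙 _)) fun a a' f ha ha' => by
    rw [presheaf_map_restrictGerm, Category.comp_id]
    simpa using restrictGerm_comp_map D B' f (h ha) (h ha') (𝟙 _)

lemma restrictComponent_restrictMap_comp {B B' : DirectedSubset A κ ν} (h : B ≤ B')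
    {Y : IndCat κ C} (φ : restrict D B' ⟶ Y) (a : A) (ha : a ∈ B.1) :
    restrictComponent D (restrictMap D h ≫ φ) a ha = restrictComponent D φ a (h ha) := by
  rw [restrictComponent_comp, restrictMap, restrictComponent_restrictHomMk, app_restrictGerm]
  simp

variable (κ ν) in
/-- The system of restrictions of a diagram to the `κ`-directed subsets with fewer than
`ν` elements. -/
def restrictFunctor : DirectedSubset A κ ν ⥤ IndCat κ C where
  obj B := restrict D B
  map f := restrictMap D (leOfHom f)
  map_id _ := rfl
  map_comp f g := restrict_hom_ext D fun a ha => by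
    rw [restrictComponent_restrictMap_comp]
    rfl

/-- The morphism from the restriction of a diagram to the whole diagram. -/
def restrictι [IsCardinalFiltered A κ] (B : DirectedSubset A κ ν) :
    restrict D B ⟶ (⟨A, D⟩ : IndCat κ C) :=
  restrictHomMk D (fun a _ => (⟨A, D⟩ : IndCat κ C).germ a (𝟙 _)) fun a a' h _ _ => by
    simpa using (⟨A, D⟩ : IndCat κ C).germ_comp_map (𝟙 _) h

variable (κ ν) in
/-- The cocone expressing that a diagram is glued from its restrictions. -/
def restrictCocone [IsCardinalFiltered A κ] : Cocone (restrictFunctor κ ν D) where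
  pt := ⟨A, D⟩
  ι :=
    { app B := restrictι D B
      naturality B B' f := Eq.trans (b := restrictι D B)
        (restrict_hom_ext D fun a ha =>
          restrictComponent_restrictMap_comp D (leOfHom f) (restrictι D B') a ha)
        (Category.comp_id (restrictι D B)).symm }

variable [Fact ν.IsRegular]

/-- If the `κ`-directed subsets with fewer than `ν` elements are cofinal among the subsets with
fewer than `ν` elements, they form a `ν`-directed poset. -/
lemma isCardinalFiltered_directedSubset
    (h : ∀ S : Set A, HasCardinalLT S ν → ∃ B : DirectedSubset A κ ν, S ⊆ B.1) :
    IsCardinalFiltered (DirectedSubset A κ ν) ν :=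
  isCardinalFiltered_preorder _ _ fun K s hK => by
    obtain ⟨B, hB⟩ := h (⋃ k, (s k).1) (hasCardinalLT_iUnion _
      (by rwa [hasCardinalLT_iff_cardinal_mk_lt]) fun k => (s k).2.2)
    exact ⟨B, fun k => (Set.subset_iUnion (fun k => (s k).1) k).trans hB⟩

/-- A diagram is the colimit in `Ind_κ(C)` of its restrictions to `κ`-directed subsets with fewer
than `ν` elements, if these are cofinal among the subsets with fewer than `ν` elements. -/
noncomputable def isColimitRestrictCocone [IsCardinalFiltered A κ]
    (h : ∀ S : Set A, HasCardinalLT S ν → ∃ B : DirectedSubset A κ ν, S ⊆ B.1) :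
    IsColimit (restrictCocone κ ν D) := by
  have h₁ (a : A) : ∃ B : DirectedSubset A κ ν, a ∈ B.1 := by
    obtain ⟨B, hB⟩ := h {a} (hasCardinalLT_of_finite _ _ (Fact.out : ν.IsRegular).aleph0_le)
    exact ⟨B, hB rfl⟩
  have h₂ (B B' : DirectedSubset A κ ν) : ∃ B'' : DirectedSubset A κ ν, B ≤ B'' ∧ B' ≤ B'' := by
    obtain ⟨B'', hB⟩ := h (B.1 ∪ B'.1)
      (hasCardinalLT_union (Fact.out : ν.IsRegular).aleph0_le B.2.2 B'.2.2)
    exact ⟨B'', Set.subset_union_left.trans hB, Set.subset_union_right.trans hB⟩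
  choose b hb using h₁
  have h₃ (s : Cocone (restrictFunctor κ ν D)) {B B' : DirectedSubset A κ ν} (hB : B ≤ B')
      (a : A) (ha : a ∈ B.1) : restrictComponent D (s.ι.app B') a (hB ha) =
        restrictComponent D (s.ι.app B) a ha := by
    rw [← s.w (homOfLE hB)]
    exact (restrictComponent_restrictMap_comp D hB _ a ha).symm
  have h₄ (s : Cocone (restrictFunctor κ ν D)) (B B' : DirectedSubset A κ ν)
      (a : A) (ha : a ∈ B.1) (ha' : a ∈ B'.1) :
      restrictComponent D (s.ι.app B) a ha = restrictComponent D (s.ι.app B') a ha' := by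
    obtain ⟨B'', hB, hB'⟩ := h₂ B B'
    rw [← h₃ s hB, ← h₃ s hB']
  -- By `h₄`, the component at `a` does not depend on the chosen subset `b a` containing `a`.
  let d (s : Cocone (restrictFunctor κ ν D)) : (restrictCocone κ ν D).pt ⟶ s.pt :=
    homMk (X := ⟨A, D⟩) (fun a => restrictComponent D (s.ι.app (b a)) a (hb a))
      fun a a' f => by
        obtain ⟨B, hB, hB'⟩ := h₂ (b a) (b a')
        rw [← h₃ s hB, ← h₃ s hB']
        exact restrictComponent_map D (s.ι.app B) f _ _
  refine { desc := d, fac := fun s B => ?_, uniq := fun s m hm => ?_ }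
  · refine restrict_hom_ext D fun a ha => (?_ : Hom.app (d s) _
      ((⟨A, D⟩ : IndCat κ C).germ a (𝟙 _)) = _)
    exact (app_germ_id (d s) a).trans (h₄ s _ _ _ _ _)
  · refine hom_ext fun a => ?_
    refine Eq.trans ?_ (congrArg (fun φ => restrictComponent D φ a (hb a)) (hm (b a)))
    exact (app_germ_id m a).symm

end Restrict

/-! ### Compact objects as retracts -/

/-- A `ν`-compact object indexed by a poset is a retract of an object indexed by a category with
fewer than `ν` morphisms, if the `κ`-directed subsets with fewer than `ν` elements are cofinal
among the subsets with fewer than `ν` elements. -/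
lemma retractClosure_indexedByLT_of_isCardinalPresentable {A : Type w} [PartialOrder A]
    [IsCardinalFiltered A κ] (D : A ⥤ C) (ν : Cardinal.{w}) [Fact ν.IsRegular]
    (h : ∀ S : Set A, HasCardinalLT S ν → ∃ B : DirectedSubset A κ ν, S ⊆ B.1)
    [IsCardinalPresentable (⟨A, D⟩ : IndCat κ C) ν] :
    (indexedByLT κ C ν).retractClosure ⟨A, D⟩ := by
  have := isCardinalFiltered_directedSubset h
  -- Compactness lifts the identity to a stage `B`; the lift `f` is a section of the cocone map.
  obtain ⟨B, f, hf⟩ := IsCardinalPresentable.exists_hom_of_isColimit ν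
    (isColimitRestrictCocone D h) (𝟙 (⟨A, D⟩ : IndCat κ C))
  refine ⟨restrict D B, ?_, ⟨⟨f, (restrictCocone κ ν D).ι.app B, hf⟩⟩⟩
  exact hasCardinalLT_arrow_of_preorder (P := B.1) (Fact.out : ν.IsRegular).aleph0_le B.2.2

/-- A final functor from a `κ`-directed poset reduces to the poset case; `h` then supplies the
required cofinality of small `κ`-directed subsets. -/
lemma isCardinalPresentable_le_retractClosure_indexedByLT (ν : Cardinal.{w}) [Fact ν.IsRegular]
    (hκν : κ < ν) (h : ∀ X : Type w, HasCardinalLT X ν →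
      HasCardinalLT (CardinalDirectedPoset.SetCardinalLT κ X) ν) :
    isCardinalPresentable (IndCat κ C) ν ≤ (indexedByLT κ C ν).retractClosure := by
  intro X hX
  obtain ⟨A, _, _, F, _⟩ := IsCardinalFiltered.exists_cardinal_directed X.J κ
  have : IsCardinalPresentable (X.reindex F) ν :=
    (isCardinalPresentable (IndCat κ C) ν).prop_of_iso (asIso (X.reindexHom F)).symm hX
  refine (indexedByLT κ C ν).retractClosure.prop_of_iso (asIso (X.reindexHom F))
    (retractClosure_indexedByLT_of_isCardinalPresentable (F ⋙ X.diag) ν fun S hS => ?_)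
  obtain ⟨B, hSB, hB, hB'⟩ :=
    Cardinal.SharplyLT.exists_isCardinalFiltered_set_of_exists_cofinal hκν
      -- The cofinal family of subsets of cardinality `< κ` can be taken to be all of them, by `h`.
      (fun X hX => ⟨Set.univ, (h X hX).of_injective _ Subtype.val_injective,
        fun x => ⟨x, trivial, le_rfl⟩⟩) S hS
  exact ⟨⟨B, hB, hB'⟩, hSB⟩

end IndCat

theorem mainTheorem7 (κ μ : Cardinal.{w}) [Fact κ.IsRegular] [Fact μ.IsRegular] (hκμ : κ ≤ μ)
    (C : Type u) [Category.{v} C] [EssentiallySmall.{w} C] :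
    EssentiallySmall.{w} (IndComp κ μ C) := by
  obtain ⟨ν, hν, hμν, h⟩ :=
    Cardinal.exists_isRegular_forall_hasCardinalLT_setCardinalLT κ μ hκμ
  have : Fact ν.IsRegular := ⟨hν⟩
  have : LocallySmall.{w} C := locallySmall_of_essentiallySmall C
  have : ObjectProperty.EssentiallySmall.{w} (isCardinalPresentable (IndCat κ C) μ) :=
    -- Compactness passes from `μ` up to `ν`, since `ν`-filtered colimits are `μ`-filtered.
    .of_le ((isCardinalPresentable_monotone _ hμν.le).trans
      (IndCat.isCardinalPresentable_le_retractClosure_indexedByLT ν (hκμ.trans_lt hμν) h))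
  infer_instance
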